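/- Let $n\ge 2$ and let $Q\subset\mathbb R^n$ be a real quadric surface, that is, a nonempty set of the form $$Q=\Big\{x=(\xi_1,\dots,\xi_n)\in\mathbb R^n : \sum_{i,k=1}^n a_{ik}\xi_i\xi_k+2\sum_{i=1}^n b_i\xi_i+c=0\Big\},$$ where $a_{ik}=a_{ki}$, $b_i$, $c$ are real and not all $a_{ik}$ are zero. Then $\mathbb R^n\setminus Q$ has at most four connected components; they are open and their union is $\mathbb R^n\setminus Q$. At least one of these components is convex if and only if there are Cartesian coordinates (orthonormal, with a suitable origin), again denoted $\xi_1,\dots,\xi_n$, in which the equation of $Q$ becomes, after multiplication by a nonzero scalar, one of the equations \begin{align*} & a_1\xi_1^2+\cdots+a_k\xi_k^2=1, && 1\le k\le n,\\ & a_1\xi_1^2-a_2\xi_2^2-\cdots-a_k\xi_k^2=1, && 2\le k\le n,\\ & a_1\xi_1^2=0,\\ & a_1\xi_1^2-a_2\xi_2^2-\cdots-a_k\xi_k^2=0, && 2\le k\le n,\\ & a_1\xi_1^2+\cdots+a_{k-1}\xi_{k-1}^2=\xi_k, && 2\le k\le n, \end{align*} where all scalars $a_i$ involved are positive. -/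

import Mathlib

/-- The left-hand side `∑ a_{ik} ξ_i ξ_k + 2 ∑ b_i ξ_i + c` of a quadratic equation on `ℝⁿ`. -/
def quadricFun {n : ℕ} (A : Matrix (Fin n) (Fin n) ℝ) (b : Fin n → ℝ) (c : ℝ)
    (x : EuclideanSpace ℝ (Fin n)) : ℝ :=
  (∑ i, ∑ k, A i k * x i * x k) + 2 * (∑ i, b i * x i) + c

/-- The locus of real points satisfying the quadratic equation. -/
def quadricSurface {n : ℕ} (A : Matrix (Fin n) (Fin n) ℝ) (b : Fin n → ℝ) (c : ℝ) :
    Set (EuclideanSpace ℝ (Fin n)) :=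
  {x | quadricFun A b c x = 0}

/-- The set of connected components of a subset `S` of a topological space. -/
def componentsOf {X : Type*} [TopologicalSpace X] (S : Set X) : Set (Set X) :=
  {U | ∃ x ∈ S, U = connectedComponentIn S x}

/-- `ListedForm n F` says that `F = 0` is one of the five canonical equations in the coordinates
`ξ_1, …, ξ_n` (here indexed from `0`), all scalars involved being positive. Where the number of
coordinates involved is at least `2`, it is written `k = m + 1` with `1 ≤ m`. -/
inductive ListedForm (n : ℕ) : (EuclideanSpace ℝ (Fin n) → ℝ) → Prop
  /-- `a_1 ξ_1² + ⋯ + a_k ξ_k² = 1`, `1 ≤ k ≤ n` -/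
  | ellipsoid (k : ℕ) (hk1 : 1 ≤ k) (hkn : k ≤ n) (a : Fin k → ℝ) (ha : ∀ i, 0 < a i) :
      ListedForm n fun ξ => (∑ i : Fin k, a i * ξ (Fin.castLE hkn i) ^ 2) - 1
  /-- `a_1 ξ_1² - a_2 ξ_2² - ⋯ - a_k ξ_k² = 1`, `2 ≤ k = m + 1 ≤ n` -/
  | hyperboloid (m : ℕ) (hm : 1 ≤ m) (hmn : m + 1 ≤ n) (a : Fin (m + 1) → ℝ)
      (ha : ∀ i, 0 < a i) :
      ListedForm n fun ξ => a 0 * ξ (Fin.castLE hmn 0) ^ 2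
        - (∑ j : Fin m, a j.succ * ξ (Fin.castLE hmn j.succ) ^ 2) - 1
  /-- `a_1 ξ_1² = 0` -/
  | hyperplane (hn : 0 < n) (a : ℝ) (ha : 0 < a) :
      ListedForm n fun ξ => a * ξ ⟨0, hn⟩ ^ 2
  /-- `a_1 ξ_1² - a_2 ξ_2² - ⋯ - a_k ξ_k² = 0`, `2 ≤ k = m + 1 ≤ n` -/
  | cone (m : ℕ) (hm : 1 ≤ m) (hmn : m + 1 ≤ n) (a : Fin (m + 1) → ℝ)
      (ha : ∀ i, 0 < a i) :
      ListedForm n fun ξ => a 0 * ξ (Fin.castLE hmn 0) ^ 2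
        - ∑ j : Fin m, a j.succ * ξ (Fin.castLE hmn j.succ) ^ 2
  /-- `a_1 ξ_1² + ⋯ + a_{k-1} ξ_{k-1}² = ξ_k`, `2 ≤ k = m + 1 ≤ n` -/
  | paraboloid (m : ℕ) (hm : 1 ≤ m) (hmn : m + 1 ≤ n) (a : Fin m → ℝ) (ha : ∀ i, 0 < a i) :
      ListedForm n fun ξ => (∑ j : Fin m, a j * ξ (Fin.castLE hmn j.castSucc) ^ 2)
        - ξ (Fin.castLE hmn (Fin.last m))

/-- The equation `f = 0` becomes, in suitable Cartesian coordinates `ξ = φ x` (`φ` an affine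
isometry of `ℝⁿ`) and after multiplication by a nonzero scalar, one of the listed equations. -/
def HasListedCanonicalForm {n : ℕ} (f : EuclideanSpace ℝ (Fin n) → ℝ) : Prop :=
  ∃ φ : EuclideanSpace ℝ (Fin n) ≃ᵃⁱ[ℝ] EuclideanSpace ℝ (Fin n),
    ∃ t : ℝ, t ≠ 0 ∧ ∃ F, ListedForm n F ∧ ∀ x, f x = t * F (φ x)

/-!
After a change of Cartesian coordinates and multiplication by a nonzero scalar, `Q` is given by
`q = 0`, `q = 1` or `q = ξ_k`, where `q` is a diagonal quadratic form, not involving `ξ_k` in the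
last case.

Let `e ≥ 0`. If `x` and `y` lie in `{q > e}` and `polar q x y ≥ 0`, then both segments of the path
from `x` through `x + y` to `y` stay in `{q > e}`. Hence every point of `{q > e}` can be joined to
`x` or to `-x`, so this set has at most two components; it is connected if `q` is positive on two
orthogonal vectors, and then it is not convex, since it misses the midpoint `0` of `x` and `-x`. So
if a component of `{q > e}` is convex, then `q` has a single positive coefficient. Conversely, for
such `q` the polar form is at least `2 e` on each of the two sheets of `{q > e}`, which makes them
convex. For `q = 0`, the side `{q < 0}` is `{-q > 0}`. The sets `{q < 1}`, `{q < ξ_k}` and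
`{q > ξ_k}` are connected, and convexity of one of them forces `q` to be semidefinite.
-/

open Set QuadraticMap

section Components

variable {X Y : Type*} [TopologicalSpace X] [TopologicalSpace Y] {S T : Set X}

theorem sUnion_componentsOf (S : Set X) : ⋃₀ componentsOf S = S := by
  refine Subset.antisymm ?_ fun x hx => ⟨_, ⟨x, hx, rfl⟩, mem_connectedComponentIn hx⟩
  rintro x ⟨_, ⟨y, -, rfl⟩, hx⟩
  exact connectedComponentIn_subset S y hx

theorem isOpen_of_mem_componentsOf [LocallyConnectedSpace X] (hS : IsOpen S) {U : Set X}
    (hU : U ∈ componentsOf S) : IsOpen U := by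
  obtain ⟨x, -, rfl⟩ := hU
  exact hS.connectedComponentIn

theorem connectedComponentIn_eq_of_joinedIn {x y : X} (h : JoinedIn S x y) :
    connectedComponentIn S x = connectedComponentIn S y :=
  connectedComponentIn_eq <|
    (isConnected_range h.somePath.continuous).isPreconnected.subset_connectedComponentIn
      ⟨0, by simp⟩ (range_subset_iff.2 h.somePath_mem) ⟨1, by simp⟩

theorem componentsOf_subset_singleton (hS : IsPreconnected S) : componentsOf S ⊆ {S} := by
  rintro _ ⟨x, hx, rfl⟩
  exact hS.connectedComponentIn hx

theorem encard_componentsOf_le_one (hS : IsPreconnected S) : (componentsOf S).encard ≤ 1 :=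
  (encard_le_encard (componentsOf_subset_singleton hS)).trans_eq (encard_singleton S)

theorem mem_componentsOf_self (hS : IsPreconnected S) (hne : S.Nonempty) : S ∈ componentsOf S :=
  hne.imp fun _ hx => ⟨hx, (hS.connectedComponentIn hx).symm⟩

theorem connectedComponentIn_union_left (hS : IsOpen S) (hT : IsOpen T) (hST : Disjoint S T)
    {x : X} (hx : x ∈ S) : connectedComponentIn (S ∪ T) x = connectedComponentIn S x := by
  have hmem : x ∈ connectedComponentIn (S ∪ T) x := mem_connectedComponentIn (Or.inl hx)
  refine Subset.antisymm ?_ (connectedComponentIn_mono x subset_union_left)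
  exact isPreconnected_connectedComponentIn.subset_connectedComponentIn hmem <|
    isPreconnected_connectedComponentIn.subset_left_of_subset_union hS hT hST
      (connectedComponentIn_subset _ _) ⟨x, hmem, hx⟩

theorem componentsOf_union (hS : IsOpen S) (hT : IsOpen T) (hST : Disjoint S T) :
    componentsOf (S ∪ T) = componentsOf S ∪ componentsOf T := by
  have hleft (x : X) (hx : x ∈ S) := connectedComponentIn_union_left hS hT hST hx
  have hright (x : X) (hx : x ∈ T) : connectedComponentIn (S ∪ T) x = connectedComponentIn T x :=
    union_comm T S ▸ connectedComponentIn_union_left hT hS hST.symm hx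
  ext U
  constructor
  · rintro ⟨x, hx | hx, rfl⟩
    exacts [Or.inl ⟨x, hx, hleft x hx⟩, Or.inr ⟨x, hx, hright x hx⟩]
  · rintro (⟨x, hx, rfl⟩ | ⟨x, hx, rfl⟩)
    exacts [⟨x, Or.inl hx, (hleft x hx).symm⟩, ⟨x, Or.inr hx, (hright x hx).symm⟩]

theorem componentsOf_setOf_ne [LinearOrder Y] [OrderClosedTopology Y] {f g : X → Y}
    (hf : Continuous f) (hg : Continuous g) :
    componentsOf {x | f x ≠ g x} =
      componentsOf {x | f x < g x} ∪ componentsOf {x | g x < f x} := by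
  rw [← componentsOf_union (isOpen_lt hf hg) (isOpen_lt hg hf)
    (disjoint_left.2 fun _ => lt_asymm)]
  simp only [ne_iff_lt_or_gt, ofPred_or]

theorem componentsOf_preimage (φ : X ≃ₜ Y) (S : Set Y) :
    componentsOf (φ ⁻¹' S) = preimage φ '' componentsOf S := by
  have hφ (y : Y) (hy : y ∈ S) :
      φ ⁻¹' connectedComponentIn S y = connectedComponentIn (φ ⁻¹' S) (φ.symm y) := by
    simpa only [φ.image_symm] using φ.symm.image_connectedComponentIn hy
  ext U
  constructor
  · rintro ⟨x, hx, rfl⟩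
    exact ⟨_, ⟨φ x, hx, rfl⟩, by rw [hφ _ hx, φ.symm_apply_apply]⟩
  · rintro ⟨_, ⟨y, hy, rfl⟩, rfl⟩
    exact ⟨φ.symm y, by simpa using hy, hφ y hy⟩

end Components

section ConvexComponents

variable {E : Type*} [AddCommGroup E] [Module ℝ E] [TopologicalSpace E] {S : Set E}

/-- Some connected component of the set `S` is convex. -/
def HasConvexComponent (S : Set E) : Prop :=
  ∃ U ∈ componentsOf S, Convex ℝ U

theorem hasConvexComponent_setOf_ne_iff {f g : E → ℝ} (hf : Continuous f) (hg : Continuous g) :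
    HasConvexComponent {x | f x ≠ g x} ↔
      HasConvexComponent {x | f x < g x} ∨ HasConvexComponent {x | g x < f x} := by
  simp only [HasConvexComponent, componentsOf_setOf_ne hf hg, mem_union, or_and_right, exists_or]

theorem HasConvexComponent.nonempty (h : HasConvexComponent S) : S.Nonempty := by
  obtain ⟨_, ⟨x, hx, -⟩, -⟩ := h
  exact ⟨x, hx⟩

theorem HasConvexComponent.convex (h : HasConvexComponent S) (hS : IsPreconnected S) :
    Convex ℝ S := by
  obtain ⟨U, hU, hconv⟩ := h
  rwa [componentsOf_subset_singleton hS hU] at hconv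

variable [IsTopologicalAddGroup E] [ContinuousSMul ℝ E]

theorem hasConvexComponent_union_of_convex {T : Set E} (hconv : Convex ℝ S) (hne : S.Nonempty)
    (hS : IsOpen S) (hT : IsOpen T) (hST : Disjoint S T) : HasConvexComponent (S ∪ T) :=
  ⟨S, componentsOf_union hS hT hST ▸ Or.inl (mem_componentsOf_self hconv.isPreconnected hne), hconv⟩

theorem hasConvexComponent_setOf_ne_zero_of_convexOn {f : E → ℝ} (hf : ConvexOn ℝ univ f)
    (hcont : Continuous f) {x : E} (hx : f x < 0) : HasConvexComponent {x | f x ≠ 0} := by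
  rw [hasConvexComponent_setOf_ne_iff hcont continuous_const]
  have hconv : Convex ℝ {x | f x < 0} := by simpa using hf.convex_lt 0
  exact Or.inl ⟨_, mem_componentsOf_self hconv.isPreconnected ⟨x, hx⟩, hconv⟩

theorem isPreconnected_preimage_of_apply_add_smul {f : E → ℝ} (hf : Continuous f) {v : E}
    (hv : ∀ x s, f (x + s • v) = f x + s) {I : Set ℝ} (hI : IsPreconnected I) :
    IsPreconnected (f ⁻¹' I) := by
  have himage : (fun p : E × ℝ => p.1 + (p.2 - f p.1) • v) '' univ ×ˢ I = f ⁻¹' I := by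
    ext x
    constructor
    · rintro ⟨⟨y, s⟩, ⟨-, hs⟩, rfl⟩
      simpa [hv] using hs
    · exact fun hx => ⟨(x, f x), ⟨mem_univ x, hx⟩, by simp⟩
  rw [← himage]
  exact (isPreconnected_univ.prod hI).image _ (by fun_prop)

end ConvexComponents

section QuadraticForm

section Module

variable {E : Type*} [AddCommGroup E] [Module ℝ E] (q : QuadraticForm ℝ E)

theorem quadraticForm_add_smul (x y : E) (a b : ℝ) :
    q (a • x + b • y) = a ^ 2 * q x + b ^ 2 * q y + a * b * polar q x y := by
  simp only [QuadraticMap.map_add, QuadraticMap.map_smul, polar_smul_left, polar_smul_right,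
    smul_eq_mul]
  ring

variable {q}

theorem convexOn_of_quadraticForm_nonneg (hq : ∀ x, 0 ≤ q x) : ConvexOn ℝ univ q := by
  refine ⟨convex_univ, fun x _ y _ a b ha hb hab => ?_⟩
  have hsub : q (x - y) = q x + q y - polar q x y := by
    simpa [sub_eq_add_neg] using quadraticForm_add_smul q x y 1 (-1)
  have hdefect : a * q x + b * q y - q (a • x + b • y) = a * b * q (x - y) := by
    obtain rfl : b = 1 - a := by linarith
    rw [quadraticForm_add_smul, hsub]
    ring
  exact sub_nonneg.1 (hdefect ▸ mul_nonneg (mul_nonneg ha hb) (hq _))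

/-- Along the line through `v` in direction `y` the function is a quadratic polynomial with leading
coefficient `q y`, so if `q y < 0` it is negative far out on both sides of `v`. -/
theorem nonneg_of_convex_setOf_quadratic_lt_zero {ℓ : E →ₗ[ℝ] ℝ} {c : ℝ} {v : E}
    (hv : 0 ≤ q v + ℓ v + c) (hconv : Convex ℝ {x | q x + ℓ x + c < 0}) (y : E) : 0 ≤ q y := by
  by_contra! hy
  set m := polar q v y + ℓ y
  set s := (q v + ℓ v + c + |m|) / -q y + 1 with hs
  have hline (r : ℝ) :
      q (v + r • y) + ℓ (v + r • y) + c = q v + ℓ v + c + r * m + r ^ 2 * q y := by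
    have := quadraticForm_add_smul q v y 1 r
    simp only [one_smul] at this
    rw [this, map_add, map_smul, smul_eq_mul]
    ring
  have hs_one : 1 ≤ s :=
    le_add_of_nonneg_left (div_nonneg (add_nonneg hv (abs_nonneg m)) (neg_pos.2 hy).le)
  have hs_mul : s * -q y = q v + ℓ v + c + |m| - q y := by
    rw [hs, add_mul, div_mul_cancel₀ _ (neg_pos.2 hy).ne']
    ring
  have hfar (r : ℝ) (hr : |r| = s) : v + r • y ∈ {x | q x + ℓ x + c < 0} := by
    have hrm : r * m ≤ s * |m| := (le_abs_self _).trans_eq (by rw [abs_mul, hr])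
    have hr2 : r ^ 2 = s ^ 2 := by rw [← sq_abs, hr]
    rw [mem_ofPred_eq, hline, hr2]
    nlinarith
  have hmem := hconv.midpoint_mem (hfar s (abs_of_pos (by linarith)))
    (hfar (-s) (by rw [abs_neg, abs_of_pos (by linarith)]))
  have hmid : midpoint ℝ (v + s • y) (v + -s • y) = v := by
    rw [midpoint_eq_smul_add, invOf_eq_inv]
    module
  exact hv.not_gt (hmid ▸ hmem)

theorem exists_pos_lt_quadraticForm_smul {x : E} (hx : 0 < q x) (e : ℝ) :
    ∃ r : ℝ, 0 < r ∧ e < q (r • x) := by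
  refine ⟨√((|e| + 1) / q x), Real.sqrt_pos.2 (by positivity), ?_⟩
  rw [QuadraticMap.map_smul, Real.mul_self_sqrt (by positivity), smul_eq_mul,
    div_mul_cancel₀ _ hx.ne']
  linarith [le_abs_self e]

variable {e : ℝ}

theorem not_convex_setOf_lt_quadraticForm (he : 0 ≤ e) {x : E} (hx : e < q x) :
    ¬Convex ℝ {x | e < q x} := by
  intro hconv
  have hmem := hconv.midpoint_mem hx (show e < q (-x) by rwa [QuadraticMap.map_neg])
  rw [midpoint_self_neg, mem_ofPred_eq, QuadraticMap.map_zero] at hmem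
  exact he.not_gt hmem

theorem segment_subset_setOf_lt_quadraticForm {x y : E} (hx : e < q x) (hy : e < q y)
    (hxy : 2 * e ≤ polar q x y) : segment ℝ x y ⊆ {z | e < q z} := by
  rintro _ ⟨a, b, ha, hb, hab, rfl⟩
  have hsq : e = a ^ 2 * e + b ^ 2 * e + a * b * (2 * e) := by
    obtain rfl : b = 1 - a := by linarith
    ring
  have hlt : a ^ 2 * e + b ^ 2 * e < a ^ 2 * q x + b ^ 2 * q y := by
    rcases ha.eq_or_lt with rfl | ha
    · obtain rfl : b = 1 := by linarith
      simpa using hy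
    · exact add_lt_add_of_lt_of_le (mul_lt_mul_of_pos_left hx (pow_pos ha 2))
        (mul_le_mul_of_nonneg_left hy.le (sq_nonneg b))
  have hmixed := mul_le_mul_of_nonneg_left hxy (mul_nonneg ha hb)
  rw [mem_ofPred_eq, quadraticForm_add_smul]
  linarith

/-- If `q` is negative semidefinite on the kernel of `ℓ`, it is Lorentzian at worst, and the sheet
of `q > e` on one side of this kernel is convex: for `y`, `z` in it, `ℓ z • y - ℓ y • z` lies in
the kernel, which bounds `polar q y z` from below. -/
theorem convex_setOf_lt_quadraticForm_and_pos {ℓ : E →ₗ[ℝ] ℝ} (hℓ : ∀ w, ℓ w = 0 → q w ≤ 0)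
    (he : 0 ≤ e) : Convex ℝ {y | e < q y ∧ 0 < ℓ y} := by
  rw [convex_iff_segment_subset]
  rintro y ⟨hy, hℓy⟩ z ⟨hz, hℓz⟩
  have hker : q (ℓ z • y + (-ℓ y) • z) ≤ 0 := hℓ _ (by simp; ring)
  rw [quadraticForm_add_smul] at hker
  have hpolar : 2 * e ≤ polar q y z := by
    refine le_of_mul_le_mul_left ?_ (mul_pos hℓz hℓy)
    have hyz : 0 ≤ (ℓ z - ℓ y) ^ 2 * e := mul_nonneg (sq_nonneg _) he
    have hy' : ℓ z ^ 2 * e ≤ ℓ z ^ 2 * q y := mul_le_mul_of_nonneg_left hy.le (sq_nonneg _)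
    have hz' : ℓ y ^ 2 * e ≤ ℓ y ^ 2 * q z := mul_le_mul_of_nonneg_left hz.le (sq_nonneg _)
    linarith
  exact subset_inter (segment_subset_setOf_lt_quadraticForm hy hz hpolar)
    ((convex_halfSpace_gt ℓ.isLinear 0).segment_subset hℓy hℓz)

end Module

variable {E : Type*} [AddCommGroup E] [Module ℝ E] [TopologicalSpace E]
  [IsTopologicalAddGroup E] [ContinuousSMul ℝ E] {q : QuadraticForm ℝ E} {e : ℝ}

theorem joinedIn_setOf_lt_of_polar_nonneg (he : 0 ≤ e) {x y : E} (hx : e < q x) (hy : e < q y)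
    (hxy : 0 ≤ polar q x y) : JoinedIn {z | e < q z} x y := by
  have hadd : e < q (x + y) := by
    rw [QuadraticMap.map_add q]
    linarith
  refine (JoinedIn.of_segment_subset ?_).trans (JoinedIn.of_segment_subset (y := x + y) ?_).symm
  · refine segment_subset_setOf_lt_quadraticForm hx hadd ?_
    rw [polar_add_right, polar_self, nsmul_eq_mul, Nat.cast_ofNat]
    linarith
  · refine segment_subset_setOf_lt_quadraticForm hy hadd ?_
    rw [polar_add_right, polar_self, polar_comm, nsmul_eq_mul, Nat.cast_ofNat]
    linarith

theorem joinedIn_or_joinedIn_neg (he : 0 ≤ e) {x y : E} (hx : e < q x) (hy : e < q y) :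
    JoinedIn {z | e < q z} x y ∨ JoinedIn {z | e < q z} (-x) y := by
  rcases le_total 0 (polar q x y) with h | h
  · exact Or.inl (joinedIn_setOf_lt_of_polar_nonneg he hx hy h)
  · refine Or.inr (joinedIn_setOf_lt_of_polar_nonneg he (by rwa [QuadraticMap.map_neg]) hy ?_)
    rwa [polar_neg_left, neg_nonneg]

theorem isPreconnected_setOf_lt_of_isOrtho (he : 0 ≤ e) {x y : E} (hx : 0 < q x) (hy : 0 < q y)
    (hxy : q.IsOrtho x y) : IsPreconnected {z | e < q z} := by
  obtain ⟨r, -, hr⟩ := exists_pos_lt_quadraticForm_smul hx e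
  obtain ⟨s, -, hs⟩ := exists_pos_lt_quadraticForm_smul hy e
  have hpolar : polar q (r • x) (s • y) = 0 := by simp [hxy.polar_eq_zero]
  have hpos := joinedIn_setOf_lt_of_polar_nonneg he hr hs hpolar.ge
  have hneg : JoinedIn {z | e < q z} (-(r • x)) (s • y) :=
    joinedIn_setOf_lt_of_polar_nonneg he (by rwa [QuadraticMap.map_neg]) hs
      (by rw [polar_neg_left, hpolar, neg_zero])
  refine IsPathConnected.isConnected ⟨r • x, hr, fun {z} hz => ?_⟩ |>.isPreconnected
  exact (joinedIn_or_joinedIn_neg he hr hz).elim id ((hpos.trans hneg.symm).trans ·)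

theorem isPreconnected_setOf_quadraticForm_lt (he : 0 < e) : IsPreconnected {z | q z < e} := by
  have hstar : StarConvex ℝ 0 {z | q z < e} := by
    intro x hx a b ha hb hab
    have hb1 : b * b ≤ 1 := mul_le_one₀ (by linarith) hb (by linarith)
    rw [smul_zero, zero_add, mem_ofPred_eq, QuadraticMap.map_smul, smul_eq_mul]
    rcases le_total (q x) 0 with h | h
    · exact (mul_nonpos_of_nonneg_of_nonpos (mul_self_nonneg b) h).trans_lt he
    · exact (mul_le_of_le_one_left h hb1).trans_lt hx
  exact (hstar.isPathConnected (by simpa using he)).isConnected.isPreconnected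

theorem encard_componentsOf_setOf_lt_quadraticForm_le (he : 0 ≤ e) :
    (componentsOf {z | e < q z}).encard ≤ 2 := by
  rcases eq_empty_or_nonempty {z | e < q z} with hS | ⟨x, hx⟩
  · simp [hS, componentsOf]
  have hsub : componentsOf {z | e < q z} ⊆
      {connectedComponentIn {z | e < q z} x, connectedComponentIn {z | e < q z} (-x)} := by
    rintro _ ⟨y, hy, rfl⟩
    exact (joinedIn_or_joinedIn_neg he hx hy).imp
      (fun h => (connectedComponentIn_eq_of_joinedIn h).symm)
      fun h => (connectedComponentIn_eq_of_joinedIn h).symm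
  calc _ ≤ _ := (encard_le_encard hsub).trans (encard_insert_le _ _)
    _ = 2 := by rw [encard_singleton, one_add_one_eq_two]

theorem encard_componentsOf_setOf_quadraticForm_ne_zero_le (hq : Continuous q) :
    (componentsOf {z | q z ≠ 0}).encard ≤ 4 := by
  have hneg : (componentsOf {z | q z < 0}).encard ≤ 2 := by
    simpa using encard_componentsOf_setOf_lt_quadraticForm_le (q := -q) le_rfl
  rw [componentsOf_setOf_ne hq continuous_const]
  calc _ ≤ _ := encard_union_le _ _
    _ ≤ 2 + 2 := add_le_add hneg (encard_componentsOf_setOf_lt_quadraticForm_le le_rfl)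
    _ = 4 := by norm_num

theorem encard_componentsOf_setOf_quadraticForm_ne_le (hq : Continuous q) (he : 0 < e) :
    (componentsOf {z | q z ≠ e}).encard ≤ 3 := by
  rw [componentsOf_setOf_ne hq continuous_const]
  calc _ ≤ _ := encard_union_le _ _
    _ ≤ 1 + 2 := add_le_add
      (encard_componentsOf_le_one (isPreconnected_setOf_quadraticForm_lt he))
      (encard_componentsOf_setOf_lt_quadraticForm_le he.le)
    _ = 3 := by norm_num

theorem HasConvexComponent.nonpos_of_isOrtho (h : HasConvexComponent {z | e < q z}) (he : 0 ≤ e)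
    {x y : E} (hx : 0 < q x) (hxy : q.IsOrtho x y) : q y ≤ 0 := by
  by_contra! hy
  obtain ⟨z, hz⟩ := h.nonempty
  exact not_convex_setOf_lt_quadraticForm he hz
    (h.convex (isPreconnected_setOf_lt_of_isOrtho he hx hy hxy))

theorem HasConvexComponent.quadraticForm_nonneg (h : HasConvexComponent {z | q z < e})
    (he : 0 < e) {v : E} (hv : e ≤ q v) (y : E) : 0 ≤ q y := by
  refine nonneg_of_convex_setOf_quadratic_lt_zero (ℓ := 0) (c := -e) (v := v) (by simpa) ?_ y
  simpa using h.convex (isPreconnected_setOf_quadraticForm_lt he)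

theorem hasConvexComponent_setOf_quadraticForm_ne (hq : Continuous q) {ℓ : E →L[ℝ] ℝ}
    (hℓ : ∀ w, ℓ w = 0 → q w ≤ 0) (he : 0 ≤ e) {x : E} (hx : 0 < q x) (hℓx : 0 < ℓ x) :
    HasConvexComponent {z | q z ≠ e} := by
  obtain ⟨r, hr, hrx⟩ := exists_pos_lt_quadraticForm_smul hx e
  have hcover : {z | q z ≠ e} =
      {z | e < q z ∧ 0 < ℓ z} ∪ ({z | q z < e} ∪ {z | e < q z ∧ ℓ z < 0}) := by
    ext z
    have hz : e < q z → ℓ z ≠ 0 := fun h h0 => ((hℓ z h0).trans he).not_gt h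
    simp only [mem_union, mem_ofPred_eq, ne_iff_lt_or_gt] at hz ⊢
    tauto
  rw [hcover]
  refine hasConvexComponent_union_of_convex
    (convex_setOf_lt_quadraticForm_and_pos (ℓ := ℓ.toLinearMap) hℓ he)
    ⟨r • x, hrx, by simpa using mul_pos hr hℓx⟩ ?_ (.union ?_ ?_) ?_
  · exact (isOpen_lt continuous_const hq).inter (isOpen_lt continuous_const ℓ.continuous)
  · exact isOpen_lt hq continuous_const
  · exact (isOpen_lt continuous_const hq).inter (isOpen_lt ℓ.continuous continuous_const)
  · refine disjoint_left.2 ?_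
    rintro z ⟨hz, hℓz⟩ (hz' | ⟨-, hℓz'⟩)
    exacts [lt_asymm hz hz', lt_asymm hℓz hℓz']

end QuadraticForm

section CartesianEquiv

variable {E F G : Type*} [NormedAddCommGroup E] [NormedSpace ℝ E] [NormedAddCommGroup F]
  [NormedSpace ℝ F] [NormedAddCommGroup G] [NormedSpace ℝ G]

theorem HasConvexComponent.preimage (φ : E ≃ᵃⁱ[ℝ] F) {S : Set F} (h : HasConvexComponent S) :
    HasConvexComponent (φ ⁻¹' S) := by
  obtain ⟨U, hU, hconv⟩ := h
  exact ⟨φ ⁻¹' U, componentsOf_preimage φ.toHomeomorph S ▸ mem_image_of_mem _ hU,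
    hconv.affine_preimage (φ.toAffineEquiv : E →ᵃ[ℝ] F)⟩

/-- The equations `f = 0` and `g = 0` agree up to a change of Cartesian coordinates and a nonzero
scalar. As in `HasListedCanonicalForm`, the change of coordinates is an affine isometry. -/
def CartesianEquiv (f : E → ℝ) (g : F → ℝ) : Prop :=
  ∃ φ : E ≃ᵃⁱ[ℝ] F, ∃ t : ℝ, t ≠ 0 ∧ ∀ x, f x = t * g (φ x)

namespace CartesianEquiv

variable {f : E → ℝ} {g : F → ℝ} {h : G → ℝ}

theorem of_eq_comp (φ : E ≃ᵃⁱ[ℝ] F) (hφ : ∀ x, f x = g (φ x)) : CartesianEquiv f g :=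
  ⟨φ, 1, one_ne_zero, by simpa using hφ⟩

theorem symm (hfg : CartesianEquiv f g) : CartesianEquiv g f := by
  obtain ⟨φ, t, ht, hφ⟩ := hfg
  exact ⟨φ.symm, t⁻¹, inv_ne_zero ht, fun y => by simp [hφ, ht]⟩

theorem trans (hfg : CartesianEquiv f g) (hgh : CartesianEquiv g h) : CartesianEquiv f h := by
  obtain ⟨φ, s, hs, hφ⟩ := hfg
  obtain ⟨ψ, t, ht, hψ⟩ := hgh
  exact ⟨φ.trans ψ, s * t, mul_ne_zero hs ht, fun x => by simp [hφ, hψ, mul_assoc]⟩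

theorem exists_eq_zero (hfg : CartesianEquiv f g) : (∃ x, f x = 0) → ∃ y, g y = 0 := by
  obtain ⟨φ, t, ht, hφ⟩ := hfg
  exact fun ⟨x, hx⟩ => ⟨φ x, by simpa [hφ, ht] using hx⟩

theorem exists_setOf_ne_zero_eq_preimage (hfg : CartesianEquiv f g) :
    ∃ φ : E ≃ᵃⁱ[ℝ] F, {x | f x ≠ 0} = φ ⁻¹' {y | g y ≠ 0} := by
  obtain ⟨φ, t, ht, hφ⟩ := hfg
  exact ⟨φ, by ext x; simp [hφ, ht]⟩

theorem encard_componentsOf_le (hfg : CartesianEquiv f g) :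
    (componentsOf {x | f x ≠ 0}).encard ≤ (componentsOf {y | g y ≠ 0}).encard := by
  obtain ⟨φ, hφ⟩ := hfg.exists_setOf_ne_zero_eq_preimage
  rw [hφ]
  exact (congrArg encard (componentsOf_preimage φ.toHomeomorph _)).trans_le (encard_image_le _ _)

theorem hasConvexComponent (hfg : CartesianEquiv f g) (hg : HasConvexComponent {y | g y ≠ 0}) :
    HasConvexComponent {x | f x ≠ 0} := by
  obtain ⟨φ, hφ⟩ := hfg.exists_setOf_ne_zero_eq_preimage
  exact hφ ▸ hg.preimage φ

end CartesianEquiv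

variable {n : ℕ} {f g : EuclideanSpace ℝ (Fin n) → ℝ}

theorem hasListedCanonicalForm_iff :
    HasListedCanonicalForm f ↔ ∃ F, ListedForm n F ∧ CartesianEquiv f F := by
  constructor
  · rintro ⟨φ, t, ht, F, hF, hφ⟩
    exact ⟨F, hF, φ, t, ht, hφ⟩
  · rintro ⟨F, hF, φ, t, ht, hφ⟩
    exact ⟨φ, t, ht, F, hF, hφ⟩

theorem CartesianEquiv.hasListedCanonicalForm (hfg : CartesianEquiv f g)
    (hg : HasListedCanonicalForm g) : HasListedCanonicalForm f := by
  obtain ⟨F, hF, hgF⟩ := hasListedCanonicalForm_iff.1 hg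
  exact hasListedCanonicalForm_iff.2 ⟨F, hF, hfg.trans hgF⟩

end CartesianEquiv

section CoordForm

variable {ι κ : Type*} [Fintype κ]

/-- The sum of squares of the coordinates `g j` with weights `a j`, as a quadratic form. The
diagonal form with coefficients `d` is `coordForm d id`. -/
noncomputable def coordForm (a : κ → ℝ) (g : κ → ι) : QuadraticForm ℝ (EuclideanSpace ℝ ι) :=
  (weightedSumSquares ℝ a).comp
    (LinearMap.funLeft ℝ ℝ g ∘ₗ (WithLp.linearEquiv 2 ℝ (ι → ℝ)).toLinearMap)

theorem coordForm_apply (a : κ → ℝ) (g : κ → ι) (ξ : EuclideanSpace ℝ ι) :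
    coordForm a g ξ = ∑ j, a j * ξ (g j) ^ 2 := by
  simp [coordForm, weightedSumSquares_apply, LinearMap.funLeft_apply, pow_two]

theorem continuous_coordForm (a : κ → ℝ) (g : κ → ι) : Continuous (coordForm a g) := by
  simp only [funext (coordForm_apply a g)]
  fun_prop

theorem coordForm_smul (t : ℝ) (a : κ → ℝ) (g : κ → ι) :
    coordForm (t • a) g = t • coordForm a g := by
  ext ξ
  simp [coordForm_apply, Finset.mul_sum, mul_assoc]

theorem coordForm_neg (a : κ → ℝ) (g : κ → ι) : coordForm (-a) g = -coordForm a g := by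
  ext ξ
  simp [coordForm_apply]

theorem coordForm_nonneg {a : κ → ℝ} (ha : ∀ j, 0 ≤ a j) (g : κ → ι) (ξ : EuclideanSpace ℝ ι) :
    0 ≤ coordForm a g ξ := by
  rw [coordForm_apply]
  exact Finset.sum_nonneg fun j _ => mul_nonneg (ha j) (sq_nonneg _)

theorem coordForm_congr {a : κ → ℝ} {g : κ → ι} {ξ η : EuclideanSpace ℝ ι}
    (h : ∀ j, a j ≠ 0 → ξ (g j) = η (g j)) : coordForm a g ξ = coordForm a g η := by
  simp only [coordForm_apply]
  refine Finset.sum_congr rfl fun j _ => ?_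
  rcases eq_or_ne (a j) 0 with ha | ha
  · simp [ha]
  · rw [h j ha]

variable [Fintype ι] {d : ι → ℝ}

theorem coordForm_comp_of_injective {g : κ → ι} (hg : g.Injective)
    (hd : ∀ i ∉ range g, d i = 0) : coordForm (d ∘ g) g = coordForm d id := by
  ext ξ
  simp only [coordForm_apply]
  exact Fintype.sum_of_injective g hg _ _ (fun i hi => by simp [hd i hi]) fun _ => rfl

variable [DecidableEq ι]

theorem coordForm_single (d : ι → ℝ) (i : ι) (r : ℝ) :
    coordForm d id (EuclideanSpace.single i r) = d i * r ^ 2 := by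
  rw [coordForm_apply, Finset.sum_eq_single i] <;> simp +contextual

theorem isOrtho_coordForm_single (d : ι → ℝ) {i j : ι} (hij : i ≠ j) (r s : ℝ) :
    (coordForm d id).IsOrtho (EuclideanSpace.single i r) (EuclideanSpace.single j s) := by
  rw [isOrtho_def]
  simp only [coordForm_apply, ← Finset.sum_add_distrib]
  refine Finset.sum_congr rfl fun k _ => ?_
  rcases eq_or_ne k i with rfl | hk
  · simp [hij]
  · simp [hk]

end CoordForm

section ListedForm

variable {n : ℕ}

theorem hasConvexComponent_setOf_coordForm_sub_sum_ne {m : ℕ} (hmn : m + 1 ≤ n)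
    {a : Fin (m + 1) → ℝ} (ha : ∀ i, 0 < a i) {e : ℝ} (he : 0 ≤ e) :
    HasConvexComponent {ξ : EuclideanSpace ℝ (Fin n) | a 0 * ξ (Fin.castLE hmn 0) ^ 2
      - (∑ j : Fin m, a j.succ * ξ (Fin.castLE hmn j.succ) ^ 2) ≠ e} := by
  set q := coordForm (Fin.cons (a 0) fun j => -a (Fin.succ j)) (Fin.castLE hmn)
  have hq (ξ : EuclideanSpace ℝ (Fin n)) : q ξ = a 0 * ξ (Fin.castLE hmn 0) ^ 2
      - ∑ j : Fin m, a j.succ * ξ (Fin.castLE hmn j.succ) ^ 2 := by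
    simp [q, coordForm_apply, Fin.sum_univ_succ, sub_eq_add_neg]
  simp only [← hq]
  refine hasConvexComponent_setOf_quadraticForm_ne (continuous_coordForm _ _)
    (ℓ := EuclideanSpace.proj (Fin.castLE hmn 0)) (fun ξ hξ => ?_) he
    (x := EuclideanSpace.single (Fin.castLE hmn 0) 1) ?_ ?_
  · have hξ0 : ξ (Fin.castLE hmn 0) = 0 := hξ
    rw [hq, hξ0, zero_pow two_ne_zero, mul_zero, zero_sub, neg_nonpos]
    exact Finset.sum_nonneg fun j _ => mul_nonneg (ha _).le (sq_nonneg _)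
  · rw [hq]
    simpa using ha 0
  · simp

theorem ListedForm.hasConvexComponent {F : EuclideanSpace ℝ (Fin n) → ℝ} (hF : ListedForm n F) :
    HasConvexComponent {ξ | F ξ ≠ 0} := by
  have hconvex {k : ℕ} (g : Fin k → Fin n) {a : Fin k → ℝ} (ha : ∀ i, 0 < a i) :
      ConvexOn ℝ univ fun ξ : EuclideanSpace ℝ (Fin n) => ∑ i, a i * ξ (g i) ^ 2 := by
    simpa only [← coordForm_apply] using
      convexOn_of_quadraticForm_nonneg (coordForm_nonneg (fun i => (ha i).le) g)
  cases hF with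
  | ellipsoid k _ hkn a ha =>
    exact hasConvexComponent_setOf_ne_zero_of_convexOn ((hconvex _ ha).add_const (-1))
      (by fun_prop) (x := 0) (by simp)
  | hyperboloid m _ hmn a ha =>
    simpa only [sub_ne_zero] using
      hasConvexComponent_setOf_coordForm_sub_sum_ne hmn ha zero_le_one
  | hyperplane hn a ha =>
    have h := hasConvexComponent_setOf_coordForm_sub_sum_ne (m := 0) hn (fun _ => ha) le_rfl
    simp only [Finset.univ_eq_empty, Finset.sum_empty, sub_zero] at h
    exact h
  | cone m _ hmn a ha =>
    exact hasConvexComponent_setOf_coordForm_sub_sum_ne hmn ha le_rfl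
  | paraboloid m _ hmn a ha =>
    refine hasConvexComponent_setOf_ne_zero_of_convexOn ((hconvex _ ha).sub ?_)
      (by fun_prop) (x := EuclideanSpace.single (Fin.castLE hmn (Fin.last m)) 1) ?_
    · exact (EuclideanSpace.proj (𝕜 := ℝ) (Fin.castLE hmn (Fin.last m))).toLinearMap.concaveOn
        convex_univ
    · simp [Fin.castLE, Fin.ext_iff, (Fin.is_lt _).ne]

theorem exists_isometry_castLE {k : ℕ} (hkn : k ≤ n) {g : Fin k → Fin n} (hg : g.Injective) :
    ∃ φ : EuclideanSpace ℝ (Fin n) ≃ₗᵢ[ℝ] EuclideanSpace ℝ (Fin n),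
      ∀ ξ j, φ ξ (Fin.castLE hkn j) = ξ (g j) := by
  obtain ⟨σ, hσ⟩ := Equiv.Perm.exists_extending_pair _ _ (Fin.castLE_injective hkn) hg
  refine ⟨LinearIsometryEquiv.piLpCongrLeft 2 ℝ ℝ σ.symm, fun ξ j => ?_⟩
  simp [LinearIsometryEquiv.piLpCongrLeft_apply, Equiv.piCongrLeft'_apply, ← hσ]

theorem hasListedCanonicalForm_of_injective {k : ℕ} (hkn : k ≤ n) {H : (Fin k → ℝ) → ℝ}
    (hH : ListedForm n fun ξ => H fun j => ξ (Fin.castLE hkn j)) {g : Fin k → Fin n}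
    (hg : g.Injective) : HasListedCanonicalForm fun ξ : EuclideanSpace ℝ (Fin n) =>
      H fun j => ξ (g j) := by
  obtain ⟨φ, hφ⟩ := exists_isometry_castLE hkn hg
  exact ⟨φ.toAffineIsometryEquiv, 1, one_ne_zero, _, hH, fun ξ => by simp [hφ]⟩

variable {d : Fin n → ℝ}

theorem hasListedCanonicalForm_coordForm_sub_one (hd : ∀ i, 0 ≤ d i) (hd0 : d ≠ 0) :
    HasListedCanonicalForm fun ξ => coordForm d id ξ - 1 := by
  obtain ⟨m, g, hg, hrange⟩ := (toFinite (Function.support d)).fin_param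
  obtain ⟨i, hi⟩ := Function.ne_iff.1 hd0
  obtain ⟨j, -⟩ : i ∈ range g := hrange ▸ hi
  have hmn : m ≤ n := by simpa using Fintype.card_le_of_injective g hg
  have hpos (j : Fin m) : 0 < d (g j) := (hd _).lt_of_ne' (hrange.subset (mem_range_self j))
  rw [← coordForm_comp_of_injective hg (by simp [hrange])]
  simp only [coordForm_apply]
  exact hasListedCanonicalForm_of_injective hmn
    (H := fun y => ∑ j, (d ∘ g) j * y j ^ 2 - 1) (.ellipsoid m j.pos hmn _ hpos) hg

theorem hasListedCanonicalForm_coordForm_sub_apply (hd : ∀ i, 0 ≤ d i) (hd0 : d ≠ 0) {k : Fin n}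
    (hk : d k = 0) : HasListedCanonicalForm fun ξ => coordForm d id ξ - ξ k := by
  obtain ⟨m, g, hg, hrange⟩ := (toFinite (Function.support d)).fin_param
  obtain ⟨i, hi⟩ := Function.ne_iff.1 hd0
  obtain ⟨j, -⟩ : i ∈ range g := hrange ▸ hi
  have hkg : k ∉ range g := by simp [hrange, hk]
  have hsnoc : (Fin.snoc g k : Fin (m + 1) → Fin n).Injective := Fin.snoc_injective_iff.2 ⟨hg, hkg⟩
  have hmn : m + 1 ≤ n := by simpa using Fintype.card_le_of_injective _ hsnoc
  have hpos (j : Fin m) : 0 < d (g j) := (hd _).lt_of_ne' (hrange.subset (mem_range_self j))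
  rw [← coordForm_comp_of_injective hg (by simp [hrange])]
  simpa [coordForm_apply] using hasListedCanonicalForm_of_injective hmn
    (H := fun y => ∑ j : Fin m, (d ∘ g) j * y j.castSucc ^ 2 - y (Fin.last m))
    (.paraboloid m j.pos hmn _ hpos) hsnoc

theorem exists_enumeration_support_of_pos {ι : Type*} [Finite ι] {d : ι → ℝ} {i : ι}
    (hi : 0 < d i) (hd : ∀ j ≠ i, d j ≤ 0) :
    ∃ (m : ℕ) (g : Fin (m + 1) → ι), g.Injective ∧ range g = Function.support d ∧
      0 < d (g 0) ∧ ∀ j : Fin m, d (g j.succ) < 0 := by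
  obtain ⟨m, g, hg, hrange⟩ := (toFinite (Function.support d \ {i})).fin_param
  refine ⟨m, Fin.cons i g, Fin.cons_injective_iff.2 ⟨by simp [hrange], hg⟩, ?_, hi, fun j => ?_⟩
  · rw [Fin.range_cons, hrange, insert_sdiff_singleton, insert_eq_of_mem hi.ne']
  · obtain ⟨hj, hji⟩ := hrange.subset (mem_range_self j)
    exact (hd _ hji).lt_of_ne hj

theorem hasListedCanonicalForm_of_pos_of_nonpos {i : Fin n} (hi : 0 < d i)
    (hd : ∀ j ≠ i, d j ≤ 0) :
    HasListedCanonicalForm (coordForm d id) ∧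
      HasListedCanonicalForm fun ξ => coordForm d id ξ - 1 := by
  obtain ⟨m, g, hg, hrange, hzero, hsucc⟩ := exists_enumeration_support_of_pos hi hd
  have hmn : m + 1 ≤ n := by simpa using Fintype.card_le_of_injective g hg
  have hpos (j : Fin (m + 1)) : 0 < |d (g j)| := abs_pos.2 (hrange.subset (mem_range_self j))
  have hform (ξ : EuclideanSpace ℝ (Fin n)) : coordForm d id ξ = |d (g 0)| * ξ (g 0) ^ 2
      - ∑ j : Fin m, |d (g j.succ)| * ξ (g j.succ) ^ 2 := by
    rw [← coordForm_comp_of_injective hg (by simp [hrange]), coordForm_apply, Fin.sum_univ_succ]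
    simp [abs_of_pos, abs_of_neg, *]
  simp only [funext hform]
  rcases m.eq_zero_or_pos with rfl | hm
  · simp only [Finset.univ_eq_empty, Finset.sum_empty, sub_zero]
    refine ⟨hasListedCanonicalForm_of_injective hmn
      (H := fun y => |d (g 0)| * y 0 ^ 2) (.hyperplane hmn _ (hpos 0)) hg, ?_⟩
    simpa using hasListedCanonicalForm_of_injective hmn
      (H := fun y => ∑ j, |d (g j)| * y j ^ 2 - 1) (.ellipsoid 1 le_rfl hmn _ hpos) hg
  · exact ⟨hasListedCanonicalForm_of_injective hmn (H := fun y => |d (g 0)| * y 0 ^ 2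
        - ∑ j : Fin m, |d (g j.succ)| * y j.succ ^ 2) (.cone m hm hmn _ hpos) hg,
      hasListedCanonicalForm_of_injective hmn (H := fun y => |d (g 0)| * y 0 ^ 2
        - (∑ j : Fin m, |d (g j.succ)| * y j.succ ^ 2) - 1) (.hyperboloid m hm hmn _ hpos) hg⟩

end ListedForm

section NormalForm

open scoped InnerProductSpace

variable {E : Type*} [NormedAddCommGroup E] [InnerProductSpace ℝ E] {n : ℕ}

theorem quadricFun_eq_inner (A : Matrix (Fin n) (Fin n) ℝ) (b : Fin n → ℝ) (c : ℝ)
    (x : EuclideanSpace ℝ (Fin n)) :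
    quadricFun A b c x = ⟪A.toEuclideanLin x, x⟫_ℝ + 2 * ⟪WithLp.toLp 2 b, x⟫_ℝ + c := by
  simp only [quadricFun, PiLp.inner_apply, RCLike.inner_apply, conj_trivial,
    Matrix.toLpLin_apply, Matrix.mulVec, dotProduct, Finset.mul_sum]
  congr 2
  · exact Finset.sum_congr rfl fun i _ => Finset.sum_congr rfl fun k _ => by ring
  · exact Finset.sum_congr rfl fun i _ => by ring

theorem exists_cartesianEquiv_coordForm_add_inner [FiniteDimensional ℝ E]
    (hn : Module.finrank ℝ E = n) {T : E →ₗ[ℝ] E} (hT : T.IsSymmetric) (hT0 : T ≠ 0) (v : E)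
    (c : ℝ) : ∃ l : Fin n → ℝ, l ≠ 0 ∧ ∃ β : EuclideanSpace ℝ (Fin n),
      CartesianEquiv (fun x => ⟪T x, x⟫_ℝ + 2 * ⟪v, x⟫_ℝ + c)
        fun ξ => coordForm l id ξ + 2 * ⟪β, ξ⟫_ℝ + c := by
  set φ := (hT.eigenvectorBasis hn).repr
  have hφ (x : E) (i : Fin n) : φ (T x) i = hT.eigenvalues hn i * φ x i :=
    hT.eigenvectorBasis_apply_self_apply hn x i
  refine ⟨hT.eigenvalues hn, fun h0 => hT0 ?_, φ v,
    .of_eq_comp φ.toAffineIsometryEquiv fun x => ?_⟩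
  · ext x
    apply φ.injective
    ext i
    simp [hφ, h0]
  · have hdiag : ⟪φ (T x), φ x⟫_ℝ = coordForm (hT.eigenvalues hn) id (φ x) := by
      simp only [coordForm_apply, PiLp.inner_apply, RCLike.inner_apply, conj_trivial, hφ, id]
      exact Finset.sum_congr rfl fun i _ => by ring
    simp [← hdiag]

theorem exists_cartesianEquiv_complete_square (l : Fin n → ℝ) (β : EuclideanSpace ℝ (Fin n))
    (c : ℝ) : ∃ (γ : EuclideanSpace ℝ (Fin n)) (c' : ℝ), (∀ i, l i ≠ 0 → γ i = 0) ∧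
      CartesianEquiv (fun ξ => coordForm l id ξ + 2 * ⟪β, ξ⟫_ℝ + c)
        fun ξ => coordForm l id ξ + 2 * ⟪γ, ξ⟫_ℝ + c' := by
  -- Where `l i = 0`, division by zero gives `w i = 0`: no shift in that coordinate.
  set w : EuclideanSpace ℝ (Fin n) := WithLp.toLp 2 fun i => β i / l i
  set γ : EuclideanSpace ℝ (Fin n) := WithLp.toLp 2 fun i => if l i = 0 then β i else 0
  refine ⟨γ, c - coordForm l id w, fun i hi => if_neg hi,
    .of_eq_comp (AffineIsometryEquiv.constVAdd ℝ _ w) fun ξ => ?_⟩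
  have hcoord (i : Fin n) : l i * ξ i ^ 2 + 2 * (ξ i * β i) =
      l i * (w i + ξ i) ^ 2 + 2 * ((w i + ξ i) * γ i) - l i * w i ^ 2 := by
    by_cases hi : l i = 0
    · simp [w, γ, hi]
    · simp only [w, γ, if_neg hi]
      field_simp
      ring
  have hsum := Finset.sum_congr rfl fun i (_ : i ∈ Finset.univ) => hcoord i
  simp only [Finset.sum_add_distrib, Finset.sum_sub_distrib, ← Finset.mul_sum] at hsum
  simp only [coordForm_apply, PiLp.inner_apply, RCLike.inner_apply, conj_trivial, id,
    AffineIsometryEquiv.coe_constVAdd, vadd_eq_add, PiLp.add_apply]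
  linarith

theorem exists_isometry_apply_eq_of_norm_eq {u v : E} (huv : ‖u‖ = ‖v‖) :
    ∃ φ : E ≃ₗᵢ[ℝ] E, φ u = v ∧ ∀ x, ∃ r : ℝ, φ x = x + r • (u - v) := by
  refine ⟨(ℝ ∙ (u - v))ᗮ.reflection, Submodule.reflection_sub huv, fun x => ?_⟩
  refine ⟨-(2 * (⟪u - v, x⟫_ℝ / ‖u - v‖ ^ 2)), ?_⟩
  rw [Submodule.reflection_orthogonal_apply, Submodule.reflection_singleton_apply]
  simp only [RCLike.ofReal_real_eq_id, id]
  module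

theorem exists_cartesianEquiv_coordForm_add_apply {l : Fin n → ℝ}
    {γ : EuclideanSpace ℝ (Fin n)} (hγ : ∀ i, l i ≠ 0 → γ i = 0) (hγ0 : γ ≠ 0) (c : ℝ) :
    ∃ k, l k = 0 ∧ ∃ r : ℝ, r ≠ 0 ∧ CartesianEquiv
      (fun ξ => coordForm l id ξ + 2 * ⟪γ, ξ⟫_ℝ + c) fun ξ => coordForm l id ξ + r * ξ k + c := by
  obtain ⟨k, hk⟩ : ∃ k, γ k ≠ 0 := by
    by_contra! h
    exact hγ0 (by ext i; exact h i)
  have hlk : l k = 0 := by_contra fun h => hk (hγ k h)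
  set v : EuclideanSpace ℝ (Fin n) := EuclideanSpace.single k ‖γ‖
  obtain ⟨φ, hφγ, hφ⟩ := exists_isometry_apply_eq_of_norm_eq (u := γ) (v := v) (by simp [v])
  refine ⟨k, hlk, 2 * ‖γ‖, by simpa using hγ0, .of_eq_comp φ.toAffineIsometryEquiv fun ξ => ?_⟩
  have hdiag : coordForm l id ξ = coordForm l id (φ ξ) := by
    obtain ⟨r, hr⟩ := hφ ξ
    refine coordForm_congr fun i hi => ?_
    have hik : i ≠ k := fun h => hi (h ▸ hlk)
    simp [hr, v, hγ i hi, hik]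
  have hlin : ⟪γ, ξ⟫_ℝ = ‖γ‖ * φ ξ k := by
    rw [← φ.inner_map_map, hφγ, EuclideanSpace.inner_single_left, conj_trivial]
  simp only [LinearIsometryEquiv.coe_toAffineIsometryEquiv, hdiag, hlin, mul_assoc]

theorem cartesianEquiv_coordForm_sub_apply {l : Fin n → ℝ} {k : Fin n} (hk : l k = 0) {r : ℝ}
    (hr : r ≠ 0) (c : ℝ) : CartesianEquiv (fun ξ => coordForm l id ξ + r * ξ k + c)
      fun ξ => coordForm ((-r)⁻¹ • l) id ξ - ξ k := by
  set w : EuclideanSpace ℝ (Fin n) := EuclideanSpace.single k (c / r)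
  refine ⟨AffineIsometryEquiv.constVAdd ℝ _ w, -r, neg_ne_zero.2 hr, fun ξ => ?_⟩
  have hdiag : coordForm l id (w + ξ) = coordForm l id ξ :=
    coordForm_congr fun i hi => by
      have hik : i ≠ k := fun h => hi (h ▸ hk)
      simp [w, hik]
  simp only [coordForm_smul, AffineIsometryEquiv.coe_constVAdd, vadd_eq_add,
    smul_apply, smul_eq_mul, hdiag, PiLp.add_apply, w, PiLp.single_apply, if_true]
  field_simp
  ring

theorem cartesianEquiv_coordForm_sub_one (l : Fin n → ℝ) {c : ℝ} (hc : c ≠ 0) :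
    CartesianEquiv (fun ξ => coordForm l id ξ + c) fun ξ => coordForm ((-c)⁻¹ • l) id ξ - 1 := by
  refine ⟨.refl ℝ _, -c, neg_ne_zero.2 hc, fun ξ => ?_⟩
  simp only [coordForm_smul, smul_apply, smul_eq_mul, AffineIsometryEquiv.coe_refl, id]
  field_simp
  ring

theorem exists_cartesianEquiv_normalForm {A : Matrix (Fin n) (Fin n) ℝ} (hA : A.IsSymm)
    (hA0 : A ≠ 0) (b : Fin n → ℝ) (c : ℝ) : ∃ d : Fin n → ℝ, d ≠ 0 ∧
      (CartesianEquiv (quadricFun A b c) (coordForm d id) ∨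
        CartesianEquiv (quadricFun A b c) (fun ξ => coordForm d id ξ - 1) ∨
        ∃ k, d k = 0 ∧ CartesianEquiv (quadricFun A b c) fun ξ => coordForm d id ξ - ξ k) := by
  have hT : A.toEuclideanLin.IsSymmetric :=
    Matrix.isSymmetric_toEuclideanLin_iff.2
      (by rwa [Matrix.IsHermitian, Matrix.conjTranspose_eq_transpose_of_trivial])
  obtain ⟨l, hl, β, hβ⟩ := exists_cartesianEquiv_coordForm_add_inner finrank_euclideanSpace_fin hT
    (by simpa using hA0) (WithLp.toLp 2 b) c
  obtain ⟨γ, c', hγ, hβγ⟩ := exists_cartesianEquiv_complete_square l β c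
  have hquad := hβ.trans hβγ
  simp only [← quadricFun_eq_inner] at hquad
  by_cases hγ0 : γ = 0
  · simp only [hγ0, inner_zero_left, mul_zero, add_zero] at hquad
    rcases eq_or_ne c' 0 with rfl | hc
    · exact ⟨l, hl, Or.inl (by simpa using hquad)⟩
    · exact ⟨(-c')⁻¹ • l, smul_ne_zero (inv_ne_zero (neg_ne_zero.2 hc)) hl,
        Or.inr (Or.inl (hquad.trans (cartesianEquiv_coordForm_sub_one l hc)))⟩
  · obtain ⟨k, hk, r, hr, hγr⟩ := exists_cartesianEquiv_coordForm_add_apply hγ hγ0 c'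
    exact ⟨(-r)⁻¹ • l, smul_ne_zero (inv_ne_zero (neg_ne_zero.2 hr)) hl, Or.inr <| Or.inr
      ⟨k, by simp [hk], hquad.trans (hγr.trans (cartesianEquiv_coordForm_sub_apply hk hr c'))⟩⟩

end NormalForm

section Classification

variable {n : ℕ} {d : Fin n → ℝ}

theorem continuous_quadricFun (A : Matrix (Fin n) (Fin n) ℝ) (b : Fin n → ℝ) (c : ℝ) :
    Continuous (quadricFun A b c) := by
  unfold quadricFun
  fun_prop

theorem HasConvexComponent.exists_pos_forall_ne_nonpos {e : ℝ} (he : 0 ≤ e)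
    (h : HasConvexComponent {ξ | e < coordForm d id ξ}) : ∃ i, 0 < d i ∧ ∀ j ≠ i, d j ≤ 0 := by
  obtain ⟨ξ, hξ⟩ := h.nonempty
  obtain ⟨i, hi⟩ : ∃ i, 0 < d i := by
    by_contra! hd
    have hneg : 0 ≤ coordForm (-d) id ξ := coordForm_nonneg (fun i => neg_nonneg.2 (hd i)) id ξ
    rw [coordForm_neg, neg_apply, neg_nonneg] at hneg
    exact (hneg.trans he).not_gt hξ
  refine ⟨i, hi, fun j hj => ?_⟩
  simpa [coordForm_single] using h.nonpos_of_isOrtho he (by simpa [coordForm_single] using hi)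
    (isOrtho_coordForm_single d hj.symm 1 1)

theorem hasListedCanonicalForm_coordForm_of_hasConvexComponent
    (h : HasConvexComponent {ξ | coordForm d id ξ ≠ 0}) :
    HasListedCanonicalForm (coordForm d id) := by
  rcases (hasConvexComponent_setOf_ne_iff (continuous_coordForm d id) continuous_const).1 h with
    hneg | hpos
  · have hneg' : HasConvexComponent {ξ | 0 < coordForm (-d) id ξ} := by
      simpa [coordForm_neg] using hneg
    obtain ⟨i, hi, hd⟩ := hneg'.exists_pos_forall_ne_nonpos le_rfl
    refine CartesianEquiv.hasListedCanonicalForm ⟨.refl ℝ _, -1, by simp, fun ξ => ?_⟩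
      (hasListedCanonicalForm_of_pos_of_nonpos hi hd).1
    simp [coordForm_neg]
  · obtain ⟨i, hi, hd⟩ := hpos.exists_pos_forall_ne_nonpos le_rfl
    exact (hasListedCanonicalForm_of_pos_of_nonpos hi hd).1

theorem hasListedCanonicalForm_coordForm_sub_one_of_hasConvexComponent
    {ξ₀ : EuclideanSpace ℝ (Fin n)} (hξ₀ : coordForm d id ξ₀ = 1)
    (h : HasConvexComponent {ξ | coordForm d id ξ ≠ 1}) :
    HasListedCanonicalForm fun ξ => coordForm d id ξ - 1 := by
  rcases (hasConvexComponent_setOf_ne_iff (continuous_coordForm d id) continuous_const).1 h with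
    hlt | hgt
  · refine hasListedCanonicalForm_coordForm_sub_one (fun i => ?_) ?_
    · simpa [coordForm_single] using
        hlt.quadraticForm_nonneg one_pos hξ₀.ge (EuclideanSpace.single i 1)
    · rintro rfl
      simp [coordForm_apply] at hξ₀
  · obtain ⟨i, hi, hd⟩ := hgt.exists_pos_forall_ne_nonpos zero_le_one
    exact (hasListedCanonicalForm_of_pos_of_nonpos hi hd).2

theorem continuous_coordForm_sub_apply (d : Fin n → ℝ) (k : Fin n) :
    Continuous fun ξ : EuclideanSpace ℝ (Fin n) => coordForm d id ξ - ξ k :=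
  (continuous_coordForm d id).sub (by fun_prop)

theorem isPreconnected_preimage_coordForm_sub_apply {k : Fin n} (hk : d k = 0) {I : Set ℝ}
    (hI : IsPreconnected I) :
    IsPreconnected ((fun ξ : EuclideanSpace ℝ (Fin n) => coordForm d id ξ - ξ k) ⁻¹' I) := by
  set v : EuclideanSpace ℝ (Fin n) := EuclideanSpace.single k (-1)
  refine isPreconnected_preimage_of_apply_add_smul (v := v)
    (continuous_coordForm_sub_apply d k) (fun ξ s => ?_) hI
  have hdiag : coordForm d id (ξ + s • v) = coordForm d id ξ := coordForm_congr fun i hi => by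
    have hik : i ≠ k := fun h => hi (h ▸ hk)
    simp [v, hik]
  simp [hdiag, v]
  ring

theorem encard_componentsOf_setOf_coordForm_sub_apply_ne_zero_le {k : Fin n} (hk : d k = 0) :
    (componentsOf {ξ : EuclideanSpace ℝ (Fin n) | coordForm d id ξ - ξ k ≠ 0}).encard ≤ 2 := by
  rw [componentsOf_setOf_ne (continuous_coordForm_sub_apply d k) continuous_const]
  have hlt := isPreconnected_preimage_coordForm_sub_apply hk (isPreconnected_Iio (a := (0 : ℝ)))
  have hgt := isPreconnected_preimage_coordForm_sub_apply hk (isPreconnected_Ioi (a := (0 : ℝ)))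
  calc _ ≤ _ := encard_union_le _ _
    _ ≤ 1 + 1 := add_le_add (encard_componentsOf_le_one hlt) (encard_componentsOf_le_one hgt)
    _ = 2 := one_add_one_eq_two

theorem nonneg_of_convex_setOf_coordForm_add_apply_lt_zero {k : Fin n} {r : ℝ}
    (h : Convex ℝ {ξ : EuclideanSpace ℝ (Fin n) | coordForm d id ξ + r * ξ k < 0}) (i : Fin n) :
    0 ≤ d i := by
  have hi := nonneg_of_convex_setOf_quadratic_lt_zero (q := coordForm d id) (v := 0) (c := 0)
    (ℓ := r • (EuclideanSpace.proj (𝕜 := ℝ) k).toLinearMap) (by simp) (by simpa using h)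
    (EuclideanSpace.single i 1)
  rwa [coordForm_single, one_pow, mul_one] at hi

theorem hasListedCanonicalForm_coordForm_sub_apply_of_hasConvexComponent (hd0 : d ≠ 0) {k : Fin n}
    (hk : d k = 0)
    (h : HasConvexComponent {ξ : EuclideanSpace ℝ (Fin n) | coordForm d id ξ - ξ k ≠ 0}) :
    HasListedCanonicalForm fun ξ => coordForm d id ξ - ξ k := by
  rcases (hasConvexComponent_setOf_ne_iff (continuous_coordForm_sub_apply d k)
    continuous_const).1 h with hlt | hgt
  · have hconv := hlt.convex (isPreconnected_preimage_coordForm_sub_apply hk isPreconnected_Iio)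
    refine hasListedCanonicalForm_coordForm_sub_apply ?_ hd0 hk
    exact nonneg_of_convex_setOf_coordForm_add_apply_lt_zero (k := k) (r := -1)
      (by simpa [sub_eq_add_neg] using hconv)
  · have hconv := hgt.convex (isPreconnected_preimage_coordForm_sub_apply hk isPreconnected_Ioi)
    refine CartesianEquiv.hasListedCanonicalForm
      ⟨(LinearIsometryEquiv.neg ℝ).toAffineIsometryEquiv, -1, by simp, fun ξ => ?_⟩
      (hasListedCanonicalForm_coordForm_sub_apply (d := -d) (k := k) ?_ (by simpa) (by simpa))
    · simp [coordForm_neg]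
      ring
    · refine nonneg_of_convex_setOf_coordForm_add_apply_lt_zero (k := k) (r := 1) ?_
      simpa [coordForm_neg, add_comm, ← sub_eq_add_neg] using hconv

theorem encard_componentsOf_quadricFun_ne_zero_le {A : Matrix (Fin n) (Fin n) ℝ} (hA : A.IsSymm)
    (hA0 : A ≠ 0) (b : Fin n → ℝ) (c : ℝ) :
    (componentsOf {x | quadricFun A b c x ≠ 0}).encard ≤ 4 := by
  obtain ⟨d, -, h | h | ⟨k, hk, h⟩⟩ := exists_cartesianEquiv_normalForm hA hA0 b c
  · exact h.encard_componentsOf_le.trans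
      (encard_componentsOf_setOf_quadraticForm_ne_zero_le (continuous_coordForm d id))
  · refine h.encard_componentsOf_le.trans ?_
    simp only [sub_ne_zero]
    exact (encard_componentsOf_setOf_quadraticForm_ne_le (continuous_coordForm d id)
      one_pos).trans (by norm_num)
  · exact h.encard_componentsOf_le.trans
      ((encard_componentsOf_setOf_coordForm_sub_apply_ne_zero_le hk).trans (by norm_num))

theorem hasListedCanonicalForm_quadricFun_of_hasConvexComponent {A : Matrix (Fin n) (Fin n) ℝ}
    (hA : A.IsSymm) (hA0 : A ≠ 0) {b : Fin n → ℝ} {c : ℝ} (hQ : ∃ x, quadricFun A b c x = 0)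
    (hconv : HasConvexComponent {x | quadricFun A b c x ≠ 0}) :
    HasListedCanonicalForm (quadricFun A b c) := by
  obtain ⟨d, hd0, h | h | ⟨k, hk, h⟩⟩ := exists_cartesianEquiv_normalForm hA hA0 b c <;>
    refine h.hasListedCanonicalForm ?_ <;>
    replace hconv := h.symm.hasConvexComponent hconv
  · exact hasListedCanonicalForm_coordForm_of_hasConvexComponent hconv
  · obtain ⟨ξ, hξ⟩ := h.exists_eq_zero hQ
    simp only [sub_ne_zero] at hconv
    exact hasListedCanonicalForm_coordForm_sub_one_of_hasConvexComponent (sub_eq_zero.1 hξ) hconv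
  · exact hasListedCanonicalForm_coordForm_sub_apply_of_hasConvexComponent hd0 hk hconv

theorem hasConvexComponent_of_hasListedCanonicalForm {f : EuclideanSpace ℝ (Fin n) → ℝ}
    (hf : HasListedCanonicalForm f) : HasConvexComponent {x | f x ≠ 0} := by
  obtain ⟨F, hF, hfF⟩ := hasListedCanonicalForm_iff.1 hf
  exact hfF.hasConvexComponent hF.hasConvexComponent

end Classification

theorem theorem1 {n : ℕ} (hn : 2 ≤ n) (A : Matrix (Fin n) (Fin n) ℝ) (hA : A.IsSymm)
    (hA0 : A ≠ 0) (b : Fin n → ℝ) (c : ℝ) (hQ : (quadricSurface A b c).Nonempty) :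
    ((componentsOf (quadricSurface A b c)ᶜ).encard ≤ 4 ∧
      (∀ U ∈ componentsOf (quadricSurface A b c)ᶜ, IsOpen U) ∧
      ⋃₀ componentsOf (quadricSurface A b c)ᶜ = (quadricSurface A b c)ᶜ) ∧
    ((∃ U ∈ componentsOf (quadricSurface A b c)ᶜ, Convex ℝ U) ↔
      HasListedCanonicalForm (quadricFun A b c)) := by
  have hopen : IsOpen (quadricSurface A b c)ᶜ :=
    isOpen_ne_fun (continuous_quadricFun A b c) continuous_const
  refine ⟨⟨?_, ?_, ?_⟩, ?_, ?_⟩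
  · exact encard_componentsOf_quadricFun_ne_zero_le hA hA0 b c
  · exact fun U => isOpen_of_mem_componentsOf hopen
  · exact sUnion_componentsOf _
  · exact hasListedCanonicalForm_quadricFun_of_hasConvexComponent hA hA0 hQ
  · exact hasConvexComponent_of_hasListedCanonicalForm
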